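/- Let $1<q<p<\infty$, $\beta>0$ and $0<\theta<\pi/2$. Write $\mathbb C_+=\{z:\operatorname{Re}z>0\}$ and $S(\theta)=\{z\in\mathbb C_+:|\arg z|<\theta\}$. Let $A:D(A)\subset\ell^q\to\ell^q$, $(Ax)_k=\lambda_kx_k$, be a diagonal operator (with maximal domain) whose eigenvalues satisfy $\operatorname{Re}\lambda_k<0$ and $-\lambda_k\in S(\theta)$ for all $k$, and let $(T(t))_{t\ge0}$, $(T(t)x)_k=e^{\lambda_kt}x_k$, be the semigroup generated by $A$. Let $D(A^*)'$ be the completion of $\ell^q$ for the norm $\|(\zeta-A)^{-1}x\|_{\ell^q}$ (for some, equivalently any, $\zeta\in\rho(A)$), regarded as a space of sequences; $T(t)$ extends to $D(A^*)'$. Let $B:\mathbb C\to D(A^*)'$ be linear and bounded, with corresponding sequence $(b_k)=B1$. Put $$\mu=\sum_k|b_k|^q\,\delta_{-\lambda_k},\qquad d\mu_{\beta,q}(z)=\Bigl(1+\frac1{|z|^{q\beta}}\Bigr)d\mu(z),\qquad d\tilde\mu_{\beta,q}(z)=|z|^q\,d\mu_{\beta,q}(1/z),$$ and let $$S_{\tilde\mu_{\beta,q}}(t)=\int_{\mathbb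 C_+}\frac1\pi\,\frac{\operatorname{Re}z}{(\operatorname{Re}z)^2+(\operatorname{Im}z-t)^2}\,d\tilde\mu_{\beta,q}(z)\qquad(t\in\mathbb R)$$ be the balayage of $\tilde\mu_{\beta,q}$. Let $\mathcal H^p_\beta(0,\infty)$ be the space of all $u\in L^p(0,\infty)$ with $(\frac{d}{dt})^\beta u\in L^p(0,\infty)$, normed by $\|u\|_{\mathcal H^p_\beta}^p=\|u\|_p^p+\|(\frac{d}{dt})^\beta u\|_p^p$, where the fractional derivative on $(0,\infty)$ of $u$ (extended by $0$) is defined via the Fourier transform, in the sense of distributions: the symbol $(i\omega)^\beta$ acts by transposition on test functions in $C_c^\infty(0,\infty)$. If $S_{\tilde\mu_{\beta,q}}\in L^{p/(p-q)}(\mathbb R)$, then $B$ is an admissible control operator with respect to $\mathcal H^p_\beta(0,\infty)$: there is a constant $m_0>0$ such that for every $u\in\mathcal H^p_\beta(0,\infty)$ the integral $\int_0^\infty T(t)Bu(t)\,dt$ (a Bochner integral in $D(A^*)'$) lies in $\ell^q$ and $$\Bigl\|\int_0^\infty T(t)Bu(t)\,dt\Bigr\|_{\ell^q}\le m_0\,\|u\|_{\mathcal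 H^p_\beta(0,\infty)}.$$ -/

import Mathlib

open MeasureTheory Set Complex
open scoped ENNReal NNReal ContDiff FourierTransform

noncomputable section

namespace WeightedAdmissibility

/-! ### The state space `ℓ^q` and diagonal operators on it -/

/-- The complex sequence space `ℓ^q`, for a real exponent `q`. -/
abbrev Ell (q : ℝ) : Type := lp (fun _ : ℕ => ℂ) (ENNReal.ofReal q)

instance factOneLeOfReal (q : ℝ) [hq : Fact (1 < q)] : Fact ((1 : ℝ≥0∞) ≤ ENNReal.ofReal q) :=
  ⟨by simpa using ENNReal.ofReal_le_ofReal hq.out.le⟩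

theorem memlp_mul {q : ℝ} {m : ℕ → ℂ} {C : ℝ} (hm : ∀ k, ‖m k‖ ≤ C) {x : ℕ → ℂ}
    (hx : Memℓp x (ENNReal.ofReal q)) :
    Memℓp (fun k => m k * x k) (ENNReal.ofReal q) := by
  have h1 : Memℓp (fun k => (C : ℂ) * x k) (ENNReal.ofReal q) := hx.const_mul (C : ℂ)
  refine Memℓp.mono' h1 (fun k => ?_)
  rw [norm_mul, norm_mul, Complex.norm_real, Real.norm_eq_abs]
  exact mul_le_mul_of_nonneg_right ((hm k).trans (le_abs_self C)) (norm_nonneg _)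

section
variable (q : ℝ) [hq : Fact (1 < q)]

/-- Multiplication of the coordinates by a bounded sequence, a bounded operator on `ℓ^q`. -/
def diagMul (m : ℕ → ℂ) (C : ℝ) (hm : ∀ k, ‖m k‖ ≤ C) : Ell q →L[ℂ] Ell q :=
  LinearMap.mkContinuous
    { toFun := fun x => (⟨fun k => m k * x k, memlp_mul hm (lp.memℓp x)⟩ : Ell q)
      map_add' := fun x y => by
        apply lp.ext; funext k; exact mul_add (m k) (x k) (y k)
      map_smul' := fun c x => by
        apply lp.ext; funext k; exact mul_left_comm (m k) c (x k) }
    C (fun x => by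
      have hC : 0 ≤ C := (norm_nonneg _).trans (hm 0)
      have h0 : ENNReal.ofReal q ≠ 0 := (zero_lt_one.trans_le
        (factOneLeOfReal q).out).ne'
      have h1 : ‖((C : ℂ) • x : Ell q)‖ = C * ‖x‖ := by
        rw [norm_smul, Complex.norm_real, Real.norm_of_nonneg hC]
      rw [← h1]
      refine lp.norm_mono h0 (fun k => ?_)
      change ‖m k * x k‖ ≤ ‖(C : ℂ) * x k‖
      rw [norm_mul, norm_mul, Complex.norm_real, Real.norm_of_nonneg hC]
      exact mul_le_mul_of_nonneg_right (hm k) (norm_nonneg _))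

@[simp] theorem diagMul_apply (m : ℕ → ℂ) (C : ℝ) (hm : ∀ k, ‖m k‖ ≤ C) (x : Ell q) (k : ℕ) :
    diagMul q m C hm x k = m k * x k := rfl

/-- The diagonal operator `A : D(A) ⊆ ℓ^q → ℓ^q`, `A x = (lam k * x k)`, with its maximal domain
`D(A) = {x ∈ ℓ^q : (lam k * x k) ∈ ℓ^q}`. -/
def diagOp (lam : ℕ → ℂ) : Ell q →ₗ.[ℂ] Ell q where
  domain :=
    { carrier := {x | Memℓp (fun k => lam k * x k) (ENNReal.ofReal q)}
      add_mem' := fun {x y} hx hy => by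
        have h := Memℓp.add hx hy
        have e : ((fun k => lam k * x k) + fun k => lam k * y k)
            = fun k => lam k * (x + y : Ell q) k := by
          funext k; exact (mul_add (lam k) (x k) (y k)).symm
        rw [e] at h; exact h
      zero_mem' := by
        have e : (fun k => lam k * (0 : Ell q) k) = fun _ : ℕ => (0 : ℂ) := by
          funext k; exact mul_zero _
        change Memℓp (fun k => lam k * (0 : Ell q) k) _
        rw [e]; exact zero_mem_ℓp'
      smul_mem' := fun c x hx => by
        have h := Memℓp.const_mul hx c
        have e : (fun k => c * (lam k * x k)) = fun k => lam k * (c • x : Ell q) k := by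
          funext k; exact mul_left_comm c (lam k) (x k)
        rw [e] at h; exact h }
  toFun :=
    { toFun := fun x => (⟨fun k => lam k * (x : Ell q) k, x.2⟩ : Ell q)
      map_add' := fun x y => by
        apply lp.ext; funext k; exact mul_add (lam k) ((x : Ell q) k) ((y : Ell q) k)
      map_smul' := fun c x => by
        apply lp.ext; funext k; exact mul_left_comm (lam k) c ((x : Ell q) k) }

end

/-- `R` is the bounded inverse `(z - A)⁻¹` of `z - A : D(A) → X`. -/
def IsResolventAt {X : Type*} [NormedAddCommGroup X] [NormedSpace ℂ X] (A : X →ₗ.[ℂ] X) (z : ℂ)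
    (R : X →L[ℂ] X) : Prop :=
  (∀ x : X, ∃ h : R x ∈ A.domain, z • R x - A ⟨R x, h⟩ = x) ∧
    ∀ x : A.domain, R (z • (x : X) - A x) = x

/-- The resolvent set `ρ(A)` of an unbounded operator `A`. -/
def resolventSetOf {X : Type*} [NormedAddCommGroup X] [NormedSpace ℂ X] (A : X →ₗ.[ℂ] X) :
    Set ℂ :=
  {z | ∃ R : X →L[ℂ] X, IsResolventAt A z R}

section
variable (q : ℝ) [hq : Fact (1 < q)]

theorem resolvent_apply {lam : ℕ → ℂ} {z : ℂ} {R : Ell q →L[ℂ] Ell q}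
    (hR : IsResolventAt (diagOp q lam) z R) (x : Ell q) (k : ℕ) :
    (z - lam k) * R x k = x k := by
  obtain ⟨h, e⟩ := hR.1 x
  have e2 := congrArg (fun y : Ell q => y k) e
  have e3 : z * R x k - lam k * R x k = x k := e2
  rw [sub_mul]; exact e3

theorem sub_ne_zero_of_mem {lam : ℕ → ℂ} {z : ℂ}
    (hz : z ∈ resolventSetOf (diagOp q lam)) (k : ℕ) : z - lam k ≠ 0 := by
  obtain ⟨R, hR⟩ := hz
  intro h
  have h1 := resolvent_apply q hR (lp.single _ k (1 : ℂ)) k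
  rw [h, zero_mul, lp.single_apply_self] at h1
  exact zero_ne_one h1

theorem resolvent_eq {lam : ℕ → ℂ} {z : ℂ} {R : Ell q →L[ℂ] Ell q}
    (hR : IsResolventAt (diagOp q lam) z R) (x : Ell q) (k : ℕ) :
    R x k = (z - lam k)⁻¹ * x k := by
  have h0 := sub_ne_zero_of_mem q ⟨R, hR⟩ k
  rw [← resolvent_apply q hR x k, inv_mul_cancel_left₀ h0]

/-! ### The extrapolation space `D(A*)'` -/

/-- The extrapolation space `D(A*)'` of the diagonal operator `A` on `ℓ^q`, that is, the completion
of `ℓ^q` for the norm `‖(z - A)⁻¹ x‖`, where `z ∈ ρ(A)`. It is realised as the space of all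
sequences `x` with `((z - lam k)⁻¹ * x k) ∈ ℓ^q`; completeness, and the facts that `ℓ^q` lies
densely in it and carries the norm just named, are proved below. -/
def extrapolationSubmodule (lam : ℕ → ℂ) (z : ℂ) : Submodule ℂ (ℕ → ℂ) where
  carrier := {x | Memℓp (fun k => (z - lam k)⁻¹ * x k) (ENNReal.ofReal q)}
  add_mem' := fun {x y} hx hy => by
    have h := Memℓp.add hx hy
    have e : ((fun k => (z - lam k)⁻¹ * x k) + fun k => (z - lam k)⁻¹ * y k)
        = fun k => (z - lam k)⁻¹ * (x + y) k := by
      funext k; exact (mul_add _ (x k) (y k)).symm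
    rw [e] at h; exact h
  zero_mem' := by
    have e : (fun k => (z - lam k)⁻¹ * (0 : ℕ → ℂ) k) = fun _ : ℕ => (0 : ℂ) := by
      funext k; exact mul_zero _
    change Memℓp (fun k => (z - lam k)⁻¹ * (0 : ℕ → ℂ) k) _
    rw [e]; exact zero_mem_ℓp'
  smul_mem' := fun c x hx => by
    have h := Memℓp.const_mul hx c
    have e : (fun k => c * ((z - lam k)⁻¹ * x k)) = fun k => (z - lam k)⁻¹ * (c • x) k := by
      funext k; exact mul_left_comm c _ (x k)
    rw [e] at h; exact h

/-- The extrapolation space as a type, to be normed by `‖(z - A)⁻¹ x‖`. -/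
def Extrapolation (lam : ℕ → ℂ) (z : ℂ) (_hz : z ∈ resolventSetOf (diagOp q lam)) : Type :=
  ↥(extrapolationSubmodule q lam z)

variable {q} {lam : ℕ → ℂ} {z : ℂ} {hz : z ∈ resolventSetOf (diagOp q lam)}

namespace Extrapolation

instance : AddCommGroup (Extrapolation q lam z hz) :=
  inferInstanceAs (AddCommGroup ↥(extrapolationSubmodule q lam z))

instance : Module ℂ (Extrapolation q lam z hz) :=
  inferInstanceAs (Module ℂ ↥(extrapolationSubmodule q lam z))

/-- The coordinates of an element of the extrapolation space. -/
def coord (x : Extrapolation q lam z hz) : ℕ → ℂ := Subtype.val x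

@[ext] theorem ext {x y : Extrapolation q lam z hz} (h : ∀ k, x.coord k = y.coord k) : x = y :=
  Subtype.ext (funext h)

/-- The extension of the resolvent `(z - A)⁻¹` to a map from the extrapolation space to `ℓ^q`. -/
def resolventMap : Extrapolation q lam z hz →ₗ[ℂ] Ell q where
  toFun x := (⟨fun k => (z - lam k)⁻¹ * x.coord k, x.2⟩ : Ell q)
  map_add' x y := by
    apply lp.ext; funext k; exact mul_add _ (x.coord k) (y.coord k)
  map_smul' c x := by
    apply lp.ext; funext k; exact mul_left_comm _ c (x.coord k)

theorem resolventMap_apply (x : Extrapolation q lam z hz) (k : ℕ) :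
    resolventMap x k = (z - lam k)⁻¹ * x.coord k := rfl

theorem resolventMap_injective :
    Function.Injective (resolventMap : Extrapolation q lam z hz →ₗ[ℂ] Ell q) := by
  intro x y h
  ext k
  have h1 : (z - lam k)⁻¹ * x.coord k = (z - lam k)⁻¹ * y.coord k :=
    congrArg (fun w : Ell q => w k) h
  exact mul_left_cancel₀ (inv_ne_zero (sub_ne_zero_of_mem q hz k)) h1

/-- The norm of the extrapolation space: `‖x‖ = ‖(z - A)⁻¹ x‖`. -/
instance : NormedAddCommGroup (Extrapolation q lam z hz) :=
  NormedAddCommGroup.induced _ _ resolventMap resolventMap_injective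

instance : NormedSpace ℂ (Extrapolation q lam z hz) :=
  NormedSpace.induced ℂ (Extrapolation q lam z hz) (Ell q) resolventMap

theorem norm_def (x : Extrapolation q lam z hz) : ‖x‖ = ‖resolventMap x‖ := rfl

theorem isometry_resolventMap :
    Isometry (resolventMap : Extrapolation q lam z hz →ₗ[ℂ] Ell q) :=
  AddMonoidHomClass.isometry_of_norm _ (fun _ => rfl)

theorem resolventMap_surjective :
    Function.Surjective (resolventMap : Extrapolation q lam z hz →ₗ[ℂ] Ell q) := by
  intro y
  have e : (fun k => (z - lam k)⁻¹ * ((z - lam k) * y k)) = y := by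
    funext k; exact inv_mul_cancel_left₀ (sub_ne_zero_of_mem q hz k) _
  refine ⟨⟨fun k => (z - lam k) * y k, ?_⟩, ?_⟩
  · change Memℓp (fun k => (z - lam k)⁻¹ * ((z - lam k) * y k)) _
    rw [e]; exact lp.memℓp y
  · apply lp.ext; exact e

instance : CompleteSpace (Extrapolation q lam z hz) := by
  have h : IsUniformInducing (resolventMap : Extrapolation q lam z hz →ₗ[ℂ] Ell q) :=
    isometry_resolventMap.isUniformInducing
  rw [h.completeSpace_congr resolventMap_surjective]
  infer_instance

/-- The canonical inclusion of `ℓ^q` in the extrapolation space. -/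
def incl : Ell q →ₗ[ℂ] Extrapolation q lam z hz where
  toFun x := ⟨fun k => x k, by
    obtain ⟨R, hR⟩ := hz
    have e : (fun k => (z - lam k)⁻¹ * x k) = R x := by
      funext k; exact (resolvent_eq q hR x k).symm
    change Memℓp (fun k => (z - lam k)⁻¹ * x k) _
    rw [e]; exact lp.memℓp (R x)⟩
  map_add' _ _ := rfl
  map_smul' _ _ := rfl

@[simp] theorem incl_coord (x : Ell q) (k : ℕ) :
    (incl x : Extrapolation q lam z hz).coord k = x k := rfl

theorem norm_incl {R : Ell q →L[ℂ] Ell q} (hR : IsResolventAt (diagOp q lam) z R) (x : Ell q) :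
    ‖(incl x : Extrapolation q lam z hz)‖ = ‖R x‖ := by
  rw [norm_def]
  congr 1
  apply lp.ext
  funext k
  exact (resolvent_eq q hR x k).symm

theorem denseRange_incl : DenseRange (incl : Ell q →ₗ[ℂ] Extrapolation q lam z hz) := by
  have hq0 : (ENNReal.ofReal q) ≠ ⊤ := ENNReal.ofReal_ne_top
  intro y
  have h := lp.hasSum_single hq0 (resolventMap y)
  rw [HasSum] at h
  refine mem_closure_of_tendsto (b := Filter.atTop)
    (f := fun s : Finset ℕ => (incl (∑ k ∈ s, lp.single (ENNReal.ofReal q) k (y.coord k)) :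
      Extrapolation q lam z hz)) ?_ (Filter.Eventually.of_forall fun s => ⟨_, rfl⟩)
  rw [isometry_resolventMap.isEmbedding.tendsto_nhds_iff]
  refine Filter.Tendsto.congr (fun s => ?_) h
  simp only [Function.comp, map_sum]
  refine Finset.sum_congr rfl (fun k _ => ?_)
  apply lp.ext
  funext j
  have h2 : (resolventMap (incl (lp.single (ENNReal.ofReal q) k (y.coord k)) :
      Extrapolation q lam z hz)) j
      = (z - lam j)⁻¹ * (lp.single (ENNReal.ofReal q) k (y.coord k) : Ell q) j := rfl
  refine Eq.trans ?_ h2.symm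
  by_cases hj : j = k
  · subst hj
    rw [lp.single_apply_self, lp.single_apply_self, resolventMap_apply]
  · rw [lp.single_apply_ne _ _ _ hj, lp.single_apply_ne _ _ _ hj, mul_zero]

end Extrapolation

/-! ### The diagonal semigroup and its extension -/

theorem norm_exp_mul_le_one {lam : ℕ → ℂ} (hlam : ∀ k, (lam k).re < 0) (t : ℝ≥0) (k : ℕ) :
    ‖exp (lam k * (t : ℝ))‖ ≤ 1 := by
  rw [Complex.norm_exp, Real.exp_le_one_iff, Complex.re_mul_ofReal]
  exact mul_nonpos_of_nonpos_of_nonneg (hlam k).le t.2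

variable (q)

/-- The semigroup generated by the diagonal operator `A`: `(T(t) x) k = exp (lam k * t) * x k`. -/
def semigroup {lam : ℕ → ℂ} (hlam : ∀ k, (lam k).re < 0) (t : ℝ≥0) : Ell q →L[ℂ] Ell q :=
  diagMul q (fun k => exp (lam k * (t : ℝ))) 1 (norm_exp_mul_le_one hlam t)

variable {q}

/-- The extension of `T(t)` to the extrapolation space. -/
def extSemigroup (hz : z ∈ resolventSetOf (diagOp q lam)) (hlam : ∀ k, (lam k).re < 0)
    (t : ℝ≥0) : Extrapolation q lam z hz →L[ℂ] Extrapolation q lam z hz :=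
  LinearMap.mkContinuous
    { toFun := fun x => ⟨fun k => exp (lam k * (t : ℝ)) * x.coord k, by
        have h := lp.memℓp (semigroup q hlam t (Extrapolation.resolventMap x))
        have e : (⇑(semigroup q hlam t (Extrapolation.resolventMap x)) : ℕ → ℂ)
            = fun k => (z - lam k)⁻¹ * (exp (lam k * (t : ℝ)) * x.coord k) := by
          funext k; exact mul_left_comm _ _ _
        rw [e] at h; exact h⟩
      map_add' := fun x y => by
        apply Extrapolation.ext; intro k; exact mul_add _ (x.coord k) (y.coord k)
      map_smul' := fun c x => by
        apply Extrapolation.ext; intro k; exact mul_left_comm _ c (x.coord k) }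
    ‖semigroup q hlam t‖ (fun x => by
      refine le_trans (le_of_eq ?_)
        ((semigroup q hlam t).le_opNorm (Extrapolation.resolventMap x))
      rw [Extrapolation.norm_def]
      congr 1
      apply lp.ext
      funext k
      exact mul_left_comm _ _ _)

@[simp] theorem extSemigroup_coord (hz : z ∈ resolventSetOf (diagOp q lam))
    (hlam : ∀ k, (lam k).re < 0) (t : ℝ≥0) (x : Extrapolation q lam z hz) (k : ℕ) :
    (extSemigroup hz hlam t x).coord k = exp (lam k * (t : ℝ)) * x.coord k := rfl

theorem extSemigroup_incl (hz : z ∈ resolventSetOf (diagOp q lam))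
    (hlam : ∀ k, (lam k).re < 0) (t : ℝ≥0) (x : Ell q) :
    extSemigroup hz hlam t (Extrapolation.incl x) = Extrapolation.incl (semigroup q hlam t x) :=
  rfl

end

/-! ### The Sobolev space `H^p_β(0,∞)` -/

/-- The transpose `(-d/dx)^β φ` of the fractional derivative of order `β`, defined on test
functions through the Fourier transform: the symbol of `(d/dx)^β` is `(2πiξ)^β`, that of its
transpose is `(-2πiξ)^β` (principal branch). -/
def fracDerivTranspose (β : ℝ) (φ : ℝ → ℂ) : ℝ → ℂ :=
  𝓕⁻ (fun ξ : ℝ => (-(2 * Real.pi * ξ * I)) ^ (β : ℂ) * 𝓕 φ ξ)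

/-- On `(0,∞)`, the function `v` is the fractional derivative `(d/dx)^β u` of the function `u`
on `(0,∞)` (extended by zero to `ℝ`), the Fourier multiplier `(2πiξ)^β` being transposed to test
functions. -/
def IsFracDeriv (β : ℝ) (u v : ℝ → ℂ) : Prop :=
  ∀ φ : ℝ → ℂ, ContDiff ℝ ∞ φ → HasCompactSupport φ → tsupport φ ⊆ Ioi 0 →
    ∫ t in Ioi (0 : ℝ), v t * φ t = ∫ t in Ioi (0 : ℝ), u t * fracDerivTranspose β φ t

/-- `L^p(0,∞)`. -/
def MemLpHalfLine (p : ℝ) (u : ℝ → ℂ) : Prop :=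
  MemLp u (ENNReal.ofReal p) (volume.restrict (Ioi (0 : ℝ)))

/-- The norm of `L^p(0,∞)`. -/
def halfLineNorm (p : ℝ) (u : ℝ → ℂ) : ℝ :=
  (eLpNorm u (ENNReal.ofReal p) (volume.restrict (Ioi (0 : ℝ)))).toReal

/-- `u ∈ H^p_β(0,∞)`: both `u` and `(d/dx)^β u` lie in `L^p(0,∞)`. -/
def MemSobolev (p β : ℝ) (u : ℝ → ℂ) : Prop :=
  MemLpHalfLine p u ∧ ∃ v, MemLpHalfLine p v ∧ IsFracDeriv β u v

open Classical in
/-- The fractional derivative `(d/dx)^β u ∈ L^p(0,∞)` of `u ∈ H^p_β(0,∞)`. -/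
def fracDeriv (p β : ℝ) (u : ℝ → ℂ) : ℝ → ℂ :=
  if h : ∃ v, MemLpHalfLine p v ∧ IsFracDeriv β u v then h.choose else 0

/-- The fractional derivative in `L^p(0,∞)` is unique. -/
theorem isFracDeriv_unique {p β : ℝ} (hp : 1 < p) {u v w : ℝ → ℂ} (hv : MemLpHalfLine p v)
    (hw : MemLpHalfLine p w) (huv : IsFracDeriv β u v) (huw : IsFracDeriv β u w) :
    v =ᵐ[volume.restrict (Ioi 0)] w := by
  have hp1 : (1 : ℝ≥0∞) ≤ ENNReal.ofReal p := by
    simpa using ENNReal.ofReal_le_ofReal hp.le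
  have hloc : ∀ f : ℝ → ℂ, MemLpHalfLine p f →
      LocallyIntegrable f (volume.restrict (Ioi (0 : ℝ))) := fun f hf => hf.locallyIntegrable hp1
  have key : ∀ᵐ x ∂(volume.restrict (Ioi (0 : ℝ))), x ∈ Ioi (0 : ℝ) → (v - w) x = 0 := by
    refine isOpen_Ioi.ae_eq_zero_of_integral_contDiff_smul_eq_zero
      (((hloc v hv).sub (hloc w hw)).locallyIntegrableOn _) ?_
    intro g hg hgc hgs
    have hg2 : ContDiff ℝ ∞ (fun x => (g x : ℂ)) := Complex.ofRealCLM.contDiff.comp hg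
    have hgc2 : HasCompactSupport (fun x => (g x : ℂ)) :=
      hgc.comp_left (g := fun y : ℝ => (y : ℂ)) Complex.ofReal_zero
    have hgs2 : tsupport (fun x => (g x : ℂ)) ⊆ Ioi 0 :=
      (closure_mono (Function.support_comp_subset (g := fun y : ℝ => (y : ℂ))
        Complex.ofReal_zero g)).trans hgs
    have e := (huv _ hg2 hgc2 hgs2).trans (huw _ hg2 hgc2 hgs2).symm
    have i1 := (hloc v hv).integrable_smul_left_of_hasCompactSupport hg.continuous hgc
    have i2 := (hloc w hw).integrable_smul_left_of_hasCompactSupport hg.continuous hgc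
    simp only [Pi.sub_apply, smul_sub]
    rw [integral_sub i1 i2, sub_eq_zero]
    simpa only [Complex.real_smul, mul_comm] using e
  filter_upwards [key, ae_restrict_mem measurableSet_Ioi] with x hx hx0
  exact sub_eq_zero.mp (hx hx0)

/-- The norm of `H^p_β(0,∞)`: `‖u‖^p = ‖u‖_p^p + ‖(d/dx)^β u‖_p^p`. -/
def sobolevNorm (p β : ℝ) (u : ℝ → ℂ) : ℝ :=
  (halfLineNorm p u ^ p + halfLineNorm p (fracDeriv p β u) ^ p) ^ (1 / p)

/-! ### Admissibility -/

/-- The control operator `B : ℂ → D(A*)'` is admissible with respect to `H^p_β(0,∞)`: for every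
input `u` the integral `∫_0^∞ T(t) B u(t) dt`, which exists as a Bochner integral in `D(A*)'`,
lies in `ℓ^q`, and its norm in `ℓ^q` is at most `m₀ ‖u‖`. -/
def IsAdmissible {q : ℝ} [Fact (1 < q)] {lam : ℕ → ℂ} {z : ℂ}
    {hz : z ∈ resolventSetOf (diagOp q lam)} (hlam : ∀ k, (lam k).re < 0)
    (B : ℂ →L[ℂ] Extrapolation q lam z hz) (p β : ℝ) : Prop :=
  ∃ m₀ : ℝ, 0 < m₀ ∧ ∀ u : ℝ → ℂ, MemSobolev p β u →
    IntegrableOn (fun t : ℝ => extSemigroup hz hlam t.toNNReal (B (u t))) (Ioi 0) ∧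
    ∃ x : Ell q,
      Extrapolation.incl x = ∫ t in Ioi (0 : ℝ), extSemigroup hz hlam t.toNNReal (B (u t)) ∧
      ‖x‖ ≤ m₀ * sobolevNorm p β u

/-! ### Measures on the right half-plane and the balayage -/

/-- The open right half-plane. -/
def rightHalfPlane : Set ℂ := {w | 0 < w.re}

/-- The sector `S(θ) = {w ∈ ℂ₊ : |arg w| < θ}`. -/
def sector (θ : ℝ) : Set ℂ := {w | w ∈ rightHalfPlane ∧ |arg w| < θ}

/-- The measure `μ = ∑ k, |b k|^q δ_{-lam k}`. -/
def carlesonMeasure (q : ℝ) (lam b : ℕ → ℂ) : Measure ℂ :=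
  Measure.sum fun k => ENNReal.ofReal (‖b k‖ ^ q) • Measure.dirac (-lam k)

/-- The measure `dμ_{β,q}(w) = (1 + 1 / |w|^{qβ}) dμ(w)`. -/
def sobolevWeight (β q : ℝ) (μ : Measure ℂ) : Measure ℂ :=
  μ.withDensity fun w => ENNReal.ofReal (1 + 1 / ‖w‖ ^ (q * β))

/-- The measure `dμ~(w) = |w|^q dμ(1/w)`. -/
def inversion (q : ℝ) (μ : Measure ℂ) : Measure ℂ :=
  (μ.map fun w => 1 / w).withDensity fun w => ENNReal.ofReal (‖w‖ ^ q)

/-- The Poisson kernel `p_w(t)` of the right half-plane, at the boundary point `i t`. -/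
def poissonKernel (w : ℂ) (t : ℝ) : ℝ := 1 / Real.pi * (w.re / (w.re ^ 2 + (w.im - t) ^ 2))

/-- The balayage `S_μ(t) = ∫_{ℂ₊} p_w(t) dμ(w)`, with values in `[0,∞]`. -/
def balayage (μ : Measure ℂ) (t : ℝ) : ℝ≥0∞ :=
  ∫⁻ w in rightHalfPlane, ENNReal.ofReal (poissonKernel w t) ∂μ

end WeightedAdmissibility

end

noncomputable section

namespace WeightedAdmissibility

/-! ### Sectorial points and the balayage -/

/-! Write `τ k = ‖lam k‖⁻¹` and `c = cos θ`. The inverted measure has its atoms at `1 / -lam k`, of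
modulus `τ k`, still in the sector. The Poisson kernel of such a point is at least a constant times
`1 / τ k` on `[0, τ k]`. Hence, up to a constant, the balayage dominates `t ↦ ∑ w k` over the `k`
with `t ≤ τ k`, where `w k = ‖b k‖^q τ k^(q-1) (1 + τ k^(qβ))` (`tsum_indicator_le_balayage`). As
`p/(p-q)` and `p/q` are conjugate exponents, Tonelli and Hölder then bound `∑ w k ∫_0^{τ k} h` by a
multiple of the `L^(p/q)` norm of `h` (`tsum_mul_setLIntegral_le`). The proof tests this with two
functions `h`.

Norm estimate: sectoriality bounds the `k`-th coordinate of the integral by `‖b k‖` times the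
Laplace transform of `‖u‖` at `c / τ k`. That transform is at most `τ k * H x` for every `x` in `(τ
k / 2, τ k]`, with `H` an averaging operator bounded on `L^p`. Taking `h = H^q` gives the `ℓ^q`
bound by `‖u‖_p`, hence by the Sobolev norm (`exists_tsum_laplace_rpow_le`).

Existence of the integral: with `h` a negative power on `(1,∞)`, the extra weight `τ k^(qβ)` shows
that `B 1` keeps finite norm after multiplication by `(1 + τ k)^ρ`, where `ρ = 1 - 1/p + β/2`. The
orbit `T(t) B 1` therefore decays like `(1 + t)^(-ρ)`, which lies in the dual of `L^p`. -/

theorem cos_mul_norm_le_re {θ : ℝ} (hθ : θ ∈ Ioo 0 (Real.pi / 2)) {w : ℂ} (hw : w ∈ sector θ) :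
    Real.cos θ * ‖w‖ ≤ w.re := by
  have h := Real.cos_le_cos_of_nonneg_of_le_pi (abs_nonneg (arg w))
    (by linarith [hθ.2, Real.pi_pos]) hw.2.le
  rw [Real.cos_abs] at h
  calc Real.cos θ * ‖w‖ ≤ Real.cos (arg w) * ‖w‖ := by gcongr
    _ = w.re := by rw [mul_comm, Complex.norm_mul_cos_arg]

/-- Inversion preserves the ratio of real part to modulus, hence the sector. -/
theorem cos_mul_norm_one_div_le_re {c : ℝ} {w : ℂ} (hw : c * ‖w‖ ≤ w.re) :
    c * ‖1 / w‖ ≤ (1 / w).re := by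
  rcases eq_or_ne w 0 with rfl | h0
  · simp
  have hn : 0 < ‖w‖ := norm_pos_iff.mpr h0
  rw [one_div, norm_inv, Complex.inv_re, Complex.normSq_eq_norm_sq, le_div_iff₀ (by positivity)]
  calc c * ‖w‖⁻¹ * ‖w‖ ^ 2 = c * ‖w‖ := by field_simp
    _ ≤ w.re := hw

/-- The denominator is the squared distance from `w` to `i t`, at most `(‖w‖ + t)^2 ≤ 4 ‖w‖^2`;
sectoriality bounds the numerator from below. -/
theorem le_poissonKernel {c t : ℝ} {w : ℂ} (hw0 : 0 < w.re) (hw : c * ‖w‖ ≤ w.re)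
    (ht : t ∈ Icc 0 ‖w‖) : c / (4 * Real.pi) * ‖w‖⁻¹ ≤ poissonKernel w t := by
  have hn : 0 < ‖w‖ := norm_pos_iff.mpr (by rintro rfl; simp at hw0)
  have hsq : w.re ^ 2 + w.im ^ 2 = ‖w‖ ^ 2 := by
    rw [← Complex.normSq_eq_norm_sq, Complex.normSq_apply]; ring
  have him : -w.im ≤ ‖w‖ := (neg_le_abs _).trans (Complex.abs_im_le_norm w)
  have hD : w.re ^ 2 + (w.im - t) ^ 2 ≤ 4 * ‖w‖ ^ 2 := by
    nlinarith [ht.1, ht.2, mul_le_mul_of_nonneg_left him ht.1,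
      mul_le_mul_of_nonneg_right ht.2 hn.le, mul_le_mul_of_nonneg_left ht.2 ht.1]
  have hpos : 0 < w.re ^ 2 + (w.im - t) ^ 2 := by positivity
  unfold poissonKernel
  calc c / (4 * Real.pi) * ‖w‖⁻¹ = 1 / Real.pi * (c * ‖w‖ / (4 * ‖w‖ ^ 2)) := by
        field_simp
    _ ≤ 1 / Real.pi * (w.re / (w.re ^ 2 + (w.im - t) ^ 2)) := by
        gcongr

theorem measurable_poissonKernel (t : ℝ) : Measurable fun w : ℂ => poissonKernel w t := by
  unfold poissonKernel
  fun_prop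

theorem measurableSet_rightHalfPlane : MeasurableSet rightHalfPlane :=
  measurableSet_lt measurable_const Complex.measurable_re

theorem balayage_inversion_sobolevWeight (q β : ℝ) {lam : ℕ → ℂ} (hlam : ∀ k, (lam k).re < 0)
    (b : ℕ → ℂ) (t : ℝ) :
    balayage (inversion q (sobolevWeight β q (carlesonMeasure q lam b))) t =
      ∑' k, ENNReal.ofReal (‖b k‖ ^ q) * (ENNReal.ofReal (1 + 1 / ‖-lam k‖ ^ (q * β)) *
        (ENNReal.ofReal (‖1 / -lam k‖ ^ q) * ENNReal.ofReal (poissonKernel (1 / -lam k) t))) := by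
  have hP : Measurable fun w : ℂ => ENNReal.ofReal (poissonKernel w t) :=
    (measurable_poissonKernel t).ennreal_ofReal
  have hPi := hP.indicator measurableSet_rightHalfPlane
  have h1 : Measurable fun w : ℂ => ENNReal.ofReal (‖w‖ ^ q) := by fun_prop
  have h2 : Measurable fun w : ℂ => ENNReal.ofReal (1 + 1 / ‖w‖ ^ (q * β)) := by fun_prop
  have h3 : Measurable fun w : ℂ => 1 / w := by fun_prop
  have hm := (h1.mul hPi).comp h3
  unfold balayage inversion sobolevWeight carlesonMeasure
  rw [← lintegral_indicator measurableSet_rightHalfPlane,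
    lintegral_withDensity_eq_lintegral_mul _ h1 hPi, lintegral_map (h1.mul hPi) h3]
  rw [show (∫⁻ a, ((fun w : ℂ => ENNReal.ofReal (‖w‖ ^ q)) *
      rightHalfPlane.indicator fun w => ENNReal.ofReal (poissonKernel w t)) (1 / a)
      ∂((Measure.sum fun k => ENNReal.ofReal (‖b k‖ ^ q) • Measure.dirac (-lam k)).withDensity
        fun w => ENNReal.ofReal (1 + 1 / ‖w‖ ^ (q * β)))) = _ from
    lintegral_withDensity_eq_lintegral_mul _ h2 hm, lintegral_sum_measure]
  refine tsum_congr fun k => ?_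
  have hk : 1 / -lam k ∈ rightHalfPlane := by
    have h0 : lam k ≠ 0 := fun h => by simpa [h] using hlam k
    change 0 < (1 / -lam k).re
    rw [one_div, Complex.inv_re]
    exact div_pos (by simpa using hlam k) (Complex.normSq_pos.mpr (neg_ne_zero.mpr h0))
  rw [lintegral_smul_measure, lintegral_dirac]
  simp only [Pi.mul_apply, indicator_of_mem hk, smul_eq_mul]

/-- The balayage dominates, up to a constant, the distribution of a sectorial measure. -/
theorem tsum_indicator_le_balayage {q β c : ℝ} (hc : 0 < c) {lam : ℕ → ℂ}
    (hlam : ∀ k, (lam k).re < 0) (hsec : ∀ k, c * ‖-lam k‖ ≤ (-lam k).re) (b : ℕ → ℂ)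
    {t : ℝ} (ht : 0 < t) :
    ∑' k, (Iic ‖lam k‖⁻¹).indicator (fun _ => ENNReal.ofReal
        (‖b k‖ ^ q * ‖lam k‖⁻¹ ^ (q - 1) * (1 + ‖lam k‖⁻¹ ^ (q * β)))) t ≤
      ENNReal.ofReal (4 * Real.pi / c) *
        balayage (inversion q (sobolevWeight β q (carlesonMeasure q lam b))) t := by
  rw [balayage_inversion_sobolevWeight q β hlam, ← ENNReal.tsum_mul_left]
  refine ENNReal.tsum_le_tsum fun k => ?_
  by_cases hk : t ∈ Iic ‖lam k‖⁻¹
  swap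
  · rw [indicator_of_notMem hk]; exact zero_le
  have h0 : lam k ≠ 0 := fun h => by simpa [h] using hlam k
  have hn : 0 < ‖lam k‖ := norm_pos_iff.mpr h0
  have hnorm : ‖1 / -lam k‖ = ‖lam k‖⁻¹ := by rw [norm_div, norm_neg, norm_one, one_div]
  have hre : 0 < (1 / -lam k).re := by
    refine lt_of_lt_of_le ?_ (cos_mul_norm_one_div_le_re (hsec k))
    rw [hnorm]; positivity
  have hP := le_poissonKernel (t := t) hre (cos_mul_norm_one_div_le_re (hsec k))
    (by rw [hnorm]; exact ⟨ht.le, hk⟩)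
  rw [hnorm] at hP
  rw [indicator_of_mem hk, hnorm, norm_neg, ← ENNReal.ofReal_mul (by positivity),
    ← ENNReal.ofReal_mul (by positivity), ← ENNReal.ofReal_mul (by positivity),
    ← ENNReal.ofReal_mul (by positivity)]
  apply ENNReal.ofReal_le_ofReal
  set τ := ‖lam k‖⁻¹ with hτ
  have hτ0 : 0 < τ := by positivity
  -- The density `‖w‖^q` of the inversion and the factor `τ⁻¹` from the Poisson kernel combine to
  -- `τ^(q-1)`.
  have e1 : 1 / ‖lam k‖ ^ (q * β) = τ ^ (q * β) := by rw [hτ, Real.inv_rpow hn.le, one_div]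
  have e2 : τ ^ (q - 1) = τ ^ q * τ⁻¹ := by rw [Real.rpow_sub_one hτ0.ne', div_eq_mul_inv]
  rw [e1, e2]
  calc ‖b k‖ ^ q * (τ ^ q * τ⁻¹) * (1 + τ ^ (q * β))
      = 4 * Real.pi / c * (‖b k‖ ^ q * ((1 + τ ^ (q * β)) *
          (τ ^ q * (c / (4 * Real.pi) * τ⁻¹)))) := by
        field_simp
    _ ≤ _ := by gcongr

/-- By Tonelli the left side is the integral of `h` against the tail sums `∑ w k` over `x ≤ τ k`,
which `S` dominates; Hölder concludes. -/
theorem tsum_mul_setLIntegral_le {s s' : ℝ} (hss : s.HolderConjugate s') {w : ℕ → ℝ≥0∞}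
    {τ : ℕ → ℝ} {S h : ℝ → ℝ≥0∞} (hS : AEMeasurable S (volume.restrict (Ioi 0)))
    (hh : Measurable h)
    (hwS : ∀ t, 0 < t → ∑' k, (Iic (τ k)).indicator (fun _ => w k) t ≤ S t) :
    ∑' k, w k * ∫⁻ x in Ioc 0 (τ k), h x ≤
      (∫⁻ x in Ioi 0, S x ^ s) ^ (1 / s) * (∫⁻ x in Ioi 0, h x ^ s') ^ (1 / s') := by
  have hm : ∀ k, Measurable ((Iic (τ k)).indicator fun _ : ℝ => w k) := fun k =>
    measurable_const.indicator measurableSet_Iic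
  calc ∑' k, w k * ∫⁻ x in Ioc 0 (τ k), h x
      = ∑' k, ∫⁻ x in Ioi 0, (Iic (τ k)).indicator (fun _ => w k) x * h x := by
        refine tsum_congr fun k => ?_
        rw [← lintegral_const_mul _ hh, ← Ioi_inter_Iic, inter_comm,
          ← Measure.restrict_restrict measurableSet_Iic, ← lintegral_indicator measurableSet_Iic]
        refine lintegral_congr fun x => ?_
        by_cases hx : x ∈ Iic (τ k) <;> simp [hx, -mem_Iic]
    _ = ∫⁻ x in Ioi 0, ∑' k, (Iic (τ k)).indicator (fun _ => w k) x * h x :=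
        (lintegral_tsum fun k => ((hm k).mul hh).aemeasurable).symm
    _ ≤ ∫⁻ x in Ioi 0, (S * h) x := by
        refine setLIntegral_mono_ae' measurableSet_Ioi (Filter.Eventually.of_forall fun x hx => ?_)
        rw [ENNReal.tsum_mul_right]
        exact mul_le_mul_left (hwS x hx) _
    _ ≤ _ := ENNReal.lintegral_mul_le_Lp_mul_Lq _ hss hS hh.aemeasurable

/-! ### The averaged Laplace transform -/

theorem setLIntegral_Ioi_comp_mul_left {x : ℝ} (hx : 0 < x) {g : ℝ → ℝ≥0∞} (hg : Measurable g) :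
    ∫⁻ y in Ioi 0, g (x * y) = ENNReal.ofReal x⁻¹ * ∫⁻ t in Ioi 0, g t := by
  have h := Real.map_volume_mul_left hx.ne'
  rw [abs_of_pos (inv_pos.mpr hx)] at h
  have h2 : ∫⁻ t in Ioi 0, g t ∂(Measure.map (fun y => x * y) volume)
      = ENNReal.ofReal x⁻¹ * ∫⁻ t in Ioi 0, g t := by
    rw [h, Measure.restrict_smul, lintegral_smul_measure, smul_eq_mul]
  rw [← h2, setLIntegral_map measurableSet_Ioi hg (by fun_prop)]
  congr 3
  ext y
  simp [hx]

/-- The averages `x⁻¹ ∫ U(t) exp (-(d t / x)) dt` of a nonnegative function. -/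
def laplaceAverage (d : ℝ) (U : ℝ → ℝ≥0∞) (x : ℝ) : ℝ≥0∞ :=
  ∫⁻ y in Ioi 0, U (x * y) * ENNReal.ofReal (Real.exp (-(d * y)))

theorem measurable_laplaceAverage (d : ℝ) {U : ℝ → ℝ≥0∞} (hU : Measurable U) :
    Measurable (laplaceAverage d U) := by
  unfold laplaceAverage
  exact Measurable.lintegral_prod_right' (f := fun z : ℝ × ℝ =>
    U (z.1 * z.2) * ENNReal.ofReal (Real.exp (-(d * z.2)))) (by fun_prop)

theorem laplace_eq_mul_laplaceAverage (d : ℝ) {U : ℝ → ℝ≥0∞} (hU : Measurable U) {x : ℝ}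
    (hx : 0 < x) :
    ∫⁻ t in Ioi 0, U t * ENNReal.ofReal (Real.exp (-(d * (t / x)))) =
      ENNReal.ofReal x * laplaceAverage d U x := by
  have h := setLIntegral_Ioi_comp_mul_left hx
    (g := fun t => U t * ENNReal.ofReal (Real.exp (-(d * (t / x))))) (by fun_prop)
  have e : laplaceAverage d U x = ∫⁻ y in Ioi 0,
      U (x * y) * ENNReal.ofReal (Real.exp (-(d * (x * y / x)))) := by
    unfold laplaceAverage
    simp only [mul_div_cancel_left₀ _ hx.ne']
  rw [e, h, ← mul_assoc, ← ENNReal.ofReal_mul hx.le, mul_inv_cancel₀ hx.ne', ENNReal.ofReal_one,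
    one_mul]

/-- Doubling the rate leaves room to move the base point: `t / x ≤ 2 t / τ` on the upper half of
`(0, τ]`. A value at the single point `τ` can thus be averaged over `x`. -/
theorem laplace_le_mul_laplaceAverage {d : ℝ} (hd : 0 ≤ d) {U : ℝ → ℝ≥0∞} (hU : Measurable U)
    {x τ : ℝ} (hx : x ∈ Ioc (τ / 2) τ) (hτ : 0 < τ) :
    ∫⁻ t in Ioi 0, U t * ENNReal.ofReal (Real.exp (-(2 * d * (t / τ)))) ≤
      ENNReal.ofReal τ * laplaceAverage d U x := by
  have hx0 : 0 < x := by linarith [hx.1]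
  refine le_trans (setLIntegral_mono_ae' (g := fun t => U t *
    ENNReal.ofReal (Real.exp (-(d * (t / x))))) measurableSet_Ioi
    (Filter.Eventually.of_forall fun t ht => ?_)) ((laplace_eq_mul_laplaceAverage d hU hx0).le.trans
      (mul_le_mul_left (ENNReal.ofReal_le_ofReal hx.2) _))
  have ht0 : (0 : ℝ) < t := ht
  gcongr U t * ENNReal.ofReal (Real.exp (-?_))
  rw [mul_comm 2 d, mul_assoc]
  gcongr
  rw [div_le_iff₀ hx0, mul_assoc, div_mul_eq_mul_div, ← mul_div_assoc, le_div_iff₀ hτ]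
  nlinarith [hx.1]

theorem lintegral_rpow_mul_exp_ne_top {s b : ℝ} (hs : -1 < s) (hb : 0 < b) :
    ∫⁻ y in Ioi (0 : ℝ), ENNReal.ofReal (y ^ s * Real.exp (-(b * y))) ≠ ⊤ := by
  have h := integrableOn_rpow_mul_exp_neg_mul_rpow hs zero_lt_one hb
  simp only [Real.rpow_one, neg_mul] at h
  exact h.lintegral_lt_top.ne

/-- The averaged Laplace transform is bounded on `L^p(0,∞)`. -/
theorem exists_lintegral_laplaceAverage_rpow_le {p d : ℝ} (hp : 1 < p) (hd : 0 < d) :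
    ∃ C : ℝ≥0∞, C ≠ ⊤ ∧ ∀ U : ℝ → ℝ≥0∞, Measurable U →
      ∫⁻ x in Ioi 0, laplaceAverage d U x ^ p ≤ C * ∫⁻ t in Ioi 0, U t ^ p := by
  have hp0 : 0 < p := by linarith
  obtain ⟨p', hpp⟩ : ∃ p', p.HolderConjugate p' := ⟨_, Real.HolderConjugate.conjExponent hp⟩
  have hp'0 : 0 < p' := hpp.symm.pos
  have hsum : p⁻¹ + p'⁻¹ = 1 := hpp.inv_add_inv_eq_one
  have hpi : p⁻¹ < 1 := inv_lt_one_of_one_lt₀ hp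
  have hp'i : 0 < p'⁻¹ := inv_pos.mpr hp'0
  -- The weight `exp (-(d y))` is split as `a * e` for Hölder in `y`. With this `γ` both `-γ p'` and
  -- `γ p - 1` equal `-1/p > -1`, so `K` and `L` converge at `0`.
  set γ : ℝ := p⁻¹ * p'⁻¹ with hγ
  set a : ℝ → ℝ≥0∞ := fun y => ENNReal.ofReal (y ^ γ * Real.exp (-(d / 2 * y))) with ha
  set e : ℝ → ℝ≥0∞ := fun y => ENNReal.ofReal (y ^ (-γ) * Real.exp (-(d / 2 * y))) with he
  have ham : Measurable a := by fun_prop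
  have hem : Measurable e := by fun_prop
  set K : ℝ≥0∞ := ∫⁻ y in Ioi 0, e y ^ p' with hK
  set L : ℝ≥0∞ := ∫⁻ y in Ioi 0, a y ^ p * ENNReal.ofReal y⁻¹ with hL
  have hpow : ∀ (g r y : ℝ), 0 < y → 0 < r →
      ENNReal.ofReal (y ^ g * Real.exp (-(d / 2 * y))) ^ r
        = ENNReal.ofReal (y ^ (g * r) * Real.exp (-(d / 2 * r * y))) := by
    intro g r y hy hr
    rw [ENNReal.ofReal_rpow_of_pos (by positivity), Real.mul_rpow (by positivity) (by positivity),
      ← Real.rpow_mul hy.le, ← Real.exp_mul]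
    congr 4; ring
  have hKt : K ≠ ⊤ := by
    have : K = ∫⁻ y in Ioi (0 : ℝ),
        ENNReal.ofReal (y ^ (-γ * p') * Real.exp (-(d / 2 * p' * y))) :=
      setLIntegral_congr_fun measurableSet_Ioi fun y hy => hpow _ _ _ hy hp'0
    rw [this]
    refine lintegral_rpow_mul_exp_ne_top ?_ (by positivity)
    have : -γ * p' = -p⁻¹ := by rw [hγ]; field_simp
    linarith
  have hLt : L ≠ ⊤ := by
    have : L = ∫⁻ y in Ioi (0 : ℝ),
        ENNReal.ofReal (y ^ (γ * p - 1) * Real.exp (-(d / 2 * p * y))) := by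
      refine setLIntegral_congr_fun measurableSet_Ioi fun y hy => ?_
      have hy0 : (0 : ℝ) < y := hy
      simp only [ha]
      rw [hpow _ _ _ hy hp0, ← ENNReal.ofReal_mul (by positivity), Real.rpow_sub_one hy0.ne']
      congr 1; ring
    rw [this]
    refine lintegral_rpow_mul_exp_ne_top ?_ (by positivity)
    have : γ * p = p'⁻¹ := by rw [hγ]; field_simp
    linarith
  refine ⟨K ^ (p / p') * L, ENNReal.mul_ne_top
    (ENNReal.rpow_ne_top_of_nonneg (by positivity) hKt) hLt, fun U hU => ?_⟩
  have hpt : ∀ x, laplaceAverage d U x ^ p ≤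
      K ^ (p / p') * ∫⁻ y in Ioi 0, U (x * y) ^ p * a y ^ p := by
    intro x
    have h1 : laplaceAverage d U x = ∫⁻ y in Ioi 0, ((fun y => U (x * y) * a y) * e) y := by
      refine setLIntegral_congr_fun measurableSet_Ioi fun y hy => ?_
      have hy0 : (0 : ℝ) < y := hy
      simp only [Pi.mul_apply, ha, he]
      rw [mul_assoc, ← ENNReal.ofReal_mul (by positivity)]
      congr 2
      rw [Real.rpow_neg hy0.le, mul_mul_mul_comm, mul_inv_cancel₀ (by positivity), one_mul,
        ← Real.exp_add]
      congr 1; ring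
    have h2 := ENNReal.lintegral_mul_le_Lp_mul_Lq (volume.restrict (Ioi (0 : ℝ))) hpp
      (f := fun y => U (x * y) * a y) (g := e) (by fun_prop) hem.aemeasurable
    calc laplaceAverage d U x ^ p
        ≤ ((∫⁻ y in Ioi 0, (U (x * y) * a y) ^ p) ^ (1 / p) * K ^ (1 / p')) ^ p := by
          rw [h1]; gcongr
      _ = _ := by
          rw [ENNReal.mul_rpow_of_nonneg _ _ hp0.le, ← ENNReal.rpow_mul, ← ENNReal.rpow_mul,
            one_div_mul_cancel hp0.ne', ENNReal.rpow_one, mul_comm, one_div_mul_eq_div]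
          congr 1
          exact lintegral_congr fun y => ENNReal.mul_rpow_of_nonneg _ _ hp0.le
  -- After Tonelli, the dilation `t = x y` in the inner integral yields the factor `y⁻¹` that enters
  -- `L`.
  have hjm : Measurable fun z : ℝ × ℝ => U (z.1 * z.2) ^ p * a z.2 ^ p := by fun_prop
  calc ∫⁻ x in Ioi 0, laplaceAverage d U x ^ p
      ≤ ∫⁻ x in Ioi 0, K ^ (p / p') * ∫⁻ y in Ioi 0, U (x * y) ^ p * a y ^ p :=
        lintegral_mono hpt
    _ = K ^ (p / p') * ∫⁻ x in Ioi 0, ∫⁻ y in Ioi 0, U (x * y) ^ p * a y ^ p :=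
        lintegral_const_mul _ hjm.lintegral_prod_right'
    _ = K ^ (p / p') * ∫⁻ y in Ioi 0, ∫⁻ x in Ioi 0, U (x * y) ^ p * a y ^ p := by
        rw [lintegral_lintegral_swap hjm.aemeasurable]
    _ = K ^ (p / p') * ∫⁻ y in Ioi 0, (a y ^ p * ENNReal.ofReal y⁻¹) * ∫⁻ t in Ioi 0, U t ^ p := by
        congr 1
        refine setLIntegral_congr_fun measurableSet_Ioi fun y hy => ?_
        have hc := setLIntegral_Ioi_comp_mul_left (mem_Ioi.mp hy) (g := fun t => U t ^ p)
          (by fun_prop)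
        rw [lintegral_mul_const _ (by fun_prop)]
        simp only [mul_comm y] at hc
        rw [hc]; ring
    _ = K ^ (p / p') * L * ∫⁻ t in Ioi 0, U t ^ p := by
        rw [lintegral_mul_const _ (by fun_prop), mul_assoc]

theorem holderConjugate_div_sub_div {p q : ℝ} (hq : 0 < q) (hqp : q < p) :
    (p / (p - q)).HolderConjugate (p / q) := by
  have h : 0 < p - q := sub_pos.mpr hqp
  rw [Real.holderConjugate_iff, one_lt_div h]
  refine ⟨by linarith, ?_⟩
  have hp : 0 < p := hq.trans hqp
  field_simp
  ring

/-! ### The Laplace–Carleson embedding -/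

/-- The Laplace–Carleson embedding for a discrete sectorial measure. -/
theorem exists_tsum_laplace_rpow_le {p q c : ℝ} (hq : 1 < q) (hqp : q < p) (hc : 0 < c)
    {w : ℕ → ℝ≥0∞} {τ : ℕ → ℝ} (hτ : ∀ k, 0 < τ k) {S : ℝ → ℝ≥0∞}
    (hS : AEMeasurable S (volume.restrict (Ioi 0)))
    (hSt : ∫⁻ x in Ioi 0, S x ^ (p / (p - q)) ≠ ⊤)
    (hwS : ∀ t, 0 < t → ∑' k, (Iic (τ k)).indicator (fun _ => w k) t ≤ S t) :
    ∃ C : ℝ≥0∞, C ≠ ⊤ ∧ ∀ U : ℝ → ℝ≥0∞, Measurable U →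
      ∑' k, w k * (ENNReal.ofReal (τ k ^ (1 - q)) *
          (∫⁻ t in Ioi 0, U t * ENNReal.ofReal (Real.exp (-(c * (t / τ k))))) ^ q) ≤
        C * (∫⁻ t in Ioi 0, U t ^ p) ^ (q / p) := by
  have hq0 : 0 < q := by linarith
  have hp0 : 0 < p := by linarith
  have hpq : 0 < p - q := sub_pos.mpr hqp
  obtain ⟨C, hC, hCU⟩ := exists_lintegral_laplaceAverage_rpow_le (hq.trans hqp) (half_pos hc)
  set A : ℝ≥0∞ := (∫⁻ x in Ioi 0, S x ^ (p / (p - q))) ^ (1 / (p / (p - q))) with hA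
  have hAt : A ≠ ⊤ := ENNReal.rpow_ne_top_of_nonneg (by positivity) hSt
  -- The `2` comes from averaging over an interval of length `τ k / 2`, `A` from Hölder, and `C`
  -- from the `L^p` bound of the average at rate `c / 2`.
  refine ⟨2 * A * C ^ (q / p), ENNReal.mul_ne_top (ENNReal.mul_ne_top ENNReal.ofNat_ne_top hAt)
    (ENNReal.rpow_ne_top_of_nonneg (by positivity) hC), fun U hU => ?_⟩
  set H := laplaceAverage (c / 2) U with hH
  have hHm : Measurable H := measurable_laplaceAverage _ hU
  have hk : ∀ k, ENNReal.ofReal (τ k ^ (1 - q)) *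
      (∫⁻ t in Ioi 0, U t * ENNReal.ofReal (Real.exp (-(c * (t / τ k))))) ^ q ≤
        2 * ∫⁻ x in Ioc 0 (τ k), H x ^ q := by
    intro k
    have h0 := hτ k
    set L := ∫⁻ t in Ioi 0, U t * ENNReal.ofReal (Real.exp (-(c * (t / τ k)))) with hL
    have h1 : ∀ x ∈ Ioc (τ k / 2) (τ k), L ^ q ≤ ENNReal.ofReal (τ k ^ q) * H x ^ q := by
      intro x hx
      have := laplace_le_mul_laplaceAverage (half_pos hc).le hU hx h0
      rw [mul_div_cancel₀ c two_ne_zero] at this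
      rw [← ENNReal.ofReal_rpow_of_pos h0, ← ENNReal.mul_rpow_of_nonneg _ _ hq0.le]
      exact ENNReal.rpow_le_rpow this hq0.le
    have h2 : L ^ q * ENNReal.ofReal (τ k / 2) ≤
        ENNReal.ofReal (τ k ^ q) * ∫⁻ x in Ioc 0 (τ k), H x ^ q := by
      calc L ^ q * ENNReal.ofReal (τ k / 2) = ∫⁻ x in Ioc (τ k / 2) (τ k), L ^ q := by
            rw [setLIntegral_const, Real.volume_Ioc, sub_half]
        _ ≤ ∫⁻ x in Ioc (τ k / 2) (τ k), ENNReal.ofReal (τ k ^ q) * H x ^ q :=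
            setLIntegral_mono_ae' measurableSet_Ioc (Filter.Eventually.of_forall h1)
        _ ≤ ∫⁻ x in Ioc 0 (τ k), ENNReal.ofReal (τ k ^ q) * H x ^ q :=
            lintegral_mono_set (Ioc_subset_Ioc_left (by positivity))
        _ = _ := lintegral_const_mul _ (by fun_prop)
    calc ENNReal.ofReal (τ k ^ (1 - q)) * L ^ q
        = ENNReal.ofReal (2 * (τ k ^ q)⁻¹) * (L ^ q * ENNReal.ofReal (τ k / 2)) := by
          rw [mul_comm (L ^ q), ← mul_assoc, ← ENNReal.ofReal_mul (by positivity),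
            Real.rpow_sub h0, Real.rpow_one]
          congr 2
          field_simp
      _ ≤ ENNReal.ofReal (2 * (τ k ^ q)⁻¹) *
          (ENNReal.ofReal (τ k ^ q) * ∫⁻ x in Ioc 0 (τ k), H x ^ q) := by gcongr
      _ = 2 * ∫⁻ x in Ioc 0 (τ k), H x ^ q := by
          rw [← mul_assoc, ← ENNReal.ofReal_mul (by positivity), mul_assoc,
            inv_mul_cancel₀ (by positivity), mul_one, ENNReal.ofReal_ofNat]
  calc ∑' k, w k * (ENNReal.ofReal (τ k ^ (1 - q)) *
          (∫⁻ t in Ioi 0, U t * ENNReal.ofReal (Real.exp (-(c * (t / τ k))))) ^ q)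
      ≤ ∑' k, 2 * (w k * ∫⁻ x in Ioc 0 (τ k), H x ^ q) := by
        refine ENNReal.tsum_le_tsum fun k => ?_
        rw [mul_left_comm 2]
        exact mul_le_mul_right (hk k) _
    _ = 2 * ∑' k, w k * ∫⁻ x in Ioc 0 (τ k), H x ^ q := ENNReal.tsum_mul_left
    _ ≤ 2 * (A * (∫⁻ x in Ioi 0, (H x ^ q) ^ (p / q)) ^ (1 / (p / q))) := by
        gcongr
        exact tsum_mul_setLIntegral_le (holderConjugate_div_sub_div hq0 hqp) hS (by fun_prop) hwS
    _ = 2 * (A * (∫⁻ x in Ioi 0, H x ^ p) ^ (q / p)) := by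
        simp only [← ENNReal.rpow_mul, mul_div_cancel₀ p hq0.ne', one_div_div]
    _ ≤ 2 * (A * (C * ∫⁻ t in Ioi 0, U t ^ p) ^ (q / p)) := by
        gcongr
        exact hCU U hU
    _ = _ := by
        rw [ENNReal.mul_rpow_of_nonneg _ _ (by positivity)]
        ring

/-- The test function `x^(-κ)` on `(1,∞)` has finite `L^(p/q)` norm because `κ p / q > 1`. For `τ k
≥ 2` the interval `(τ k / 2, τ k]` lies in `(1,∞)` and already contributes `τ k^(1-κ) / 2`. -/
theorem tsum_mul_rpow_ne_top {p q κ : ℝ} (hq : 0 < q) (hqp : q < p) (hκ : q / p < κ)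
    {w : ℕ → ℝ≥0∞} {τ : ℕ → ℝ} {S : ℝ → ℝ≥0∞}
    (hS : AEMeasurable S (volume.restrict (Ioi 0)))
    (hSt : ∫⁻ x in Ioi 0, S x ^ (p / (p - q)) ≠ ⊤)
    (hwS : ∀ t, 0 < t → ∑' k, (Iic (τ k)).indicator (fun _ => w k) t ≤ S t) :
    ∑' k, w k * ENNReal.ofReal ((Ici 2).indicator (fun x => x ^ (1 - κ)) (τ k)) ≠ ⊤ := by
  have hp : 0 < p := hq.trans hqp
  have hpq : 0 < p - q := sub_pos.mpr hqp
  have hκ0 : 0 < κ := lt_trans (by positivity) hκ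
  set h : ℝ → ℝ≥0∞ := (Ioi 1).indicator fun x => ENNReal.ofReal (x ^ (-κ)) with hh
  have hhm : Measurable h := Measurable.indicator (by fun_prop) measurableSet_Ioi
  have hht : ∫⁻ x in Ioi 0, h x ^ (p / q) ≠ ⊤ := by
    have e : ∀ x, h x ^ (p / q) =
        (Ioi 1).indicator (fun x => ENNReal.ofReal (x ^ (-κ * (p / q)))) x := by
      intro x
      by_cases hx : x ∈ Ioi (1 : ℝ)
      · have hx0 : (0 : ℝ) < x := zero_lt_one.trans hx
        rw [hh, indicator_of_mem hx, indicator_of_mem hx,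
          ENNReal.ofReal_rpow_of_pos (by positivity), Real.rpow_mul hx0.le]
      · rw [hh, indicator_of_notMem hx, indicator_of_notMem hx,
          ENNReal.zero_rpow_of_pos (by positivity)]
    simp only [e]
    refine ne_top_of_le_ne_top ?_ (setLIntegral_le_lintegral _ _)
    rw [lintegral_indicator measurableSet_Ioi]
    refine (integrableOn_Ioi_rpow_of_lt ?_ zero_lt_one).lintegral_lt_top.ne
    have : 1 < κ * (p / q) := by
      rw [div_lt_iff₀ hp] at hκ
      rw [← mul_div_assoc, one_lt_div hq]; exact hκ
    linarith
  have hk : ∀ k, ENNReal.ofReal ((Ici 2).indicator (fun x => x ^ (1 - κ)) (τ k)) ≤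
      2 * ∫⁻ x in Ioc 0 (τ k), h x := by
    intro k
    by_cases hx : τ k ∈ Ici (2 : ℝ)
    swap
    · rw [indicator_of_notMem hx]; simp
    have h2 : (2 : ℝ) ≤ τ k := hx
    have h0 : 0 < τ k := by linarith
    rw [indicator_of_mem hx]
    calc ENNReal.ofReal (τ k ^ (1 - κ))
        = 2 * ∫⁻ x in Ioc (τ k / 2) (τ k), ENNReal.ofReal (τ k ^ (-κ)) := by
          rw [setLIntegral_const, Real.volume_Ioc, sub_half,
            show (2 : ℝ≥0∞) = ENNReal.ofReal 2 by simp, ← ENNReal.ofReal_mul (by positivity),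
            ← ENNReal.ofReal_mul (by positivity), sub_eq_add_neg, Real.rpow_add h0, Real.rpow_one]
          congr 1; ring
      _ ≤ 2 * ∫⁻ x in Ioc (τ k / 2) (τ k), h x := by
          gcongr 2 * ?_
          refine setLIntegral_mono_ae' measurableSet_Ioc (Filter.Eventually.of_forall fun x hx => ?_)
          have hx1 : x ∈ Ioi (1 : ℝ) := lt_of_le_of_lt (by linarith) hx.1
          rw [hh, indicator_of_mem hx1]
          exact ENNReal.ofReal_le_ofReal (Real.rpow_le_rpow_of_nonpos (zero_lt_one.trans hx1) hx.2
            (by linarith))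
      _ ≤ 2 * ∫⁻ x in Ioc 0 (τ k), h x := by
          gcongr 2 * ?_
          exact lintegral_mono_set (Ioc_subset_Ioc_left (by positivity))
  have hle : ∑' k, w k * ENNReal.ofReal ((Ici 2).indicator (fun x => x ^ (1 - κ)) (τ k)) ≤
      2 * ∑' k, w k * ∫⁻ x in Ioc 0 (τ k), h x := by
    rw [← ENNReal.tsum_mul_left]
    refine ENNReal.tsum_le_tsum fun k => ?_
    rw [mul_left_comm 2]
    gcongr
    exact hk k
  refine ne_top_of_le_ne_top (ENNReal.mul_ne_top ENNReal.ofNat_ne_top ?_) hle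
  refine ne_top_of_le_ne_top (ENNReal.mul_ne_top ?_ ?_)
    (tsum_mul_setLIntegral_le (holderConjugate_div_sub_div hq hqp) hS hhm hwS)
  · exact ENNReal.rpow_ne_top_of_nonneg (by positivity) hSt
  · exact ENNReal.rpow_ne_top_of_nonneg (by positivity) hht

/-! ### Sequences in `ℓ^q` and coordinates of the extrapolation space -/

theorem exists_ell_norm_le_of_tsum_le {q : ℝ} (hq : 1 < q) {x : ℕ → ℂ} {D : ℝ≥0∞} (hD : D ≠ ⊤)
    (h : ∑' k, ‖x k‖ₑ ^ q ≤ D) :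
    ∃ y : Ell q, (∀ k, y k = x k) ∧ ‖y‖ ≤ (D ^ (1 / q)).toReal := by
  have hq0 : 0 < q := by linarith
  have hqr : (ENNReal.ofReal q).toReal = q := ENNReal.toReal_ofReal hq0.le
  have e : ∀ k, (‖x k‖ₑ ^ q).toReal = ‖x k‖ ^ q := fun k => by
    rw [← ENNReal.toReal_rpow, toReal_enorm]
  have hne : ∑' k, ‖x k‖ₑ ^ q ≠ ⊤ := ne_top_of_le_ne_top hD h
  have hsum : Summable fun k => ‖x k‖ ^ q := by
    simpa only [e] using ENNReal.summable_toReal hne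
  have hx : Memℓp x (ENNReal.ofReal q) := by
    rw [memℓp_gen_iff (by rwa [hqr]), hqr]; exact hsum
  obtain ⟨y, hy⟩ : ∃ y : Ell q, ∀ k, y k = x k := ⟨⟨x, hx⟩, fun _ => rfl⟩
  refine ⟨y, hy, ?_⟩
  have hn := lp.norm_rpow_eq_tsum (by rwa [hqr]) y
  simp only [hqr, hy] at hn
  rw [← ENNReal.toReal_rpow, one_div,
    Real.le_rpow_inv_iff_of_pos (lp.norm_nonneg' _) ENNReal.toReal_nonneg hq0, hn]
  calc ∑' k, ‖x k‖ ^ q = (∑' k, ‖x k‖ₑ ^ q).toReal := by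
        rw [ENNReal.tsum_toReal_eq fun k => ENNReal.rpow_ne_top_of_nonneg hq0.le enorm_ne_top]
        simp only [e]
    _ ≤ D.toReal := ENNReal.toReal_mono hD h

section
variable {q : ℝ} [hq : Fact (1 < q)] {lam : ℕ → ℂ} {z : ℂ}
  {hz : z ∈ resolventSetOf (diagOp q lam)}

/-- The `k`-th coordinate, as a continuous linear functional on the extrapolation space. -/
def coordCLM (hz : z ∈ resolventSetOf (diagOp q lam)) (k : ℕ) :
    Extrapolation q lam z hz →L[ℂ] ℂ :=
  LinearMap.mkContinuous
    { toFun := fun x => x.coord k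
      map_add' := fun _ _ => rfl
      map_smul' := fun _ _ => rfl }
    ‖z - lam k‖ (fun x => by
      have h0 := sub_ne_zero_of_mem q hz k
      have h1 : x.coord k = (z - lam k) * Extrapolation.resolventMap x k := by
        rw [Extrapolation.resolventMap_apply, mul_inv_cancel_left₀ h0]
      change ‖x.coord k‖ ≤ _
      rw [h1, norm_mul, Extrapolation.norm_def]
      gcongr
      exact lp.norm_apply_le_norm (zero_lt_one.trans_le (factOneLeOfReal q).out).ne' _ _)

@[simp] theorem coordCLM_apply (k : ℕ) (x : Extrapolation q lam z hz) :
    coordCLM hz k x = x.coord k := rfl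

/-- The resolvent acts on the `k`-th unit vector as multiplication by `(z - lam k)⁻¹`, so its
operator norm serves as the bound. -/
theorem exists_norm_inv_sub_le (hz : z ∈ resolventSetOf (diagOp q lam)) :
    ∃ M : ℝ, 0 ≤ M ∧ ∀ k, ‖(z - lam k)⁻¹‖ ≤ M := by
  obtain ⟨R, hR⟩ := hz
  have hp0 : ENNReal.ofReal q ≠ 0 := (zero_lt_one.trans_le (factOneLeOfReal q).out).ne'
  refine ⟨‖R‖, norm_nonneg _, fun k => ?_⟩
  have h1 := resolvent_eq q hR (lp.single _ k (1 : ℂ)) k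
  rw [lp.single_apply_self, mul_one] at h1
  rw [← h1]
  refine (lp.norm_apply_le_norm hp0 _ _).trans ((R.le_opNorm _).trans ?_)
  rw [lp.norm_single (pos_iff_ne_zero.mpr hp0), norm_one, mul_one]

/-- The isometry onto `ℓ^q` reduces the claim to `ℓ^q`, where, `q` being finite, a vector is the
limit of its finite truncations. -/
theorem aestronglyMeasurable_of_coord {α : Type*} [MeasurableSpace α] {ν : Measure α}
    {F : α → Extrapolation q lam z hz}
    (hF : ∀ k, AEStronglyMeasurable (fun t => (F t).coord k) ν) : AEStronglyMeasurable F ν := by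
  have hemb := (Extrapolation.isometry_resolventMap (q := q) (lam := lam) (hz := hz)).isEmbedding
  rw [← hemb.aestronglyMeasurable_comp_iff]
  refine aestronglyMeasurable_of_tendsto_ae Filter.atTop
    (f := fun (s : Finset ℕ) t => ∑ k ∈ s, lp.single (E := fun _ => ℂ) (ENNReal.ofReal q) k
      (Extrapolation.resolventMap (F t) k))
    (fun s => ?_) (Filter.Eventually.of_forall fun t =>
      lp.hasSum_single ENNReal.ofReal_ne_top (Extrapolation.resolventMap (F t)))
  refine Finset.aestronglyMeasurable_fun_sum s fun k _ => ?_
  refine (lp.isometry_single k).continuous.comp_aestronglyMeasurable ?_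
  simp only [Extrapolation.resolventMap_apply]
  exact (hF k).const_mul _

end

/-! ### Decay of the extended semigroup -/

/-- The exponential rates `c / τ` need not be bounded below. This trades them for one polynomial
rate in `t`, at the cost of a weight in `τ`. -/
theorem exists_exp_neg_mul_le_one_add_rpow {c ρ : ℝ} (hc : 0 < c) (hρ : 0 < ρ) :
    ∃ C : ℝ, 0 < C ∧ ∀ t τ : ℝ, 0 ≤ t → 0 < τ →
      Real.exp (-(c * (t / τ))) ≤ C * (1 + τ) ^ ρ * (1 + t) ^ (-ρ) := by
  -- `m ≤ c / ρ` gives `1 + m t / τ ≤ exp (c t / (τ ρ))`, and `m ≤ 1` gives `m (1 + t) ≤ (1 + τ) (1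
  -- + m t / τ)`; the product is then raised to the power `ρ`.
  set m : ℝ := min 1 (c / ρ) with hm
  have hm0 : 0 < m := lt_min zero_lt_one (by positivity)
  refine ⟨m⁻¹ ^ ρ, by positivity, fun t τ ht hτ => ?_⟩
  have h1 : m * (1 + t) ≤ (1 + τ) * Real.exp (c * (t / τ) / ρ) := by
    have h2 : 1 + m * (t / τ) ≤ Real.exp (c * (t / τ) / ρ) := by
      have h3 := Real.add_one_le_exp (c * (t / τ) / ρ)
      have h4 : m * (t / τ) ≤ c / ρ * (t / τ) :=
        mul_le_mul_of_nonneg_right (min_le_right _ _) (by positivity)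
      have h5 : c * (t / τ) / ρ = c / ρ * (t / τ) := by ring
      linarith
    have h6 : m * (1 + t) ≤ (1 + τ) * (1 + m * (t / τ)) := by
      have e : (1 + τ) * (1 + m * (t / τ)) = 1 + τ + m * (t / τ) + m * t := by
        field_simp
        ring
      rw [e]
      have : m ≤ 1 := min_le_left _ _
      have : 0 ≤ m * (t / τ) := by positivity
      nlinarith
    exact h6.trans (mul_le_mul_of_nonneg_left h2 (by positivity))
  have h7 : (m * (1 + t)) ^ ρ ≤ (1 + τ) ^ ρ * Real.exp (c * (t / τ)) := by
    refine (Real.rpow_le_rpow (by positivity) h1 hρ.le).trans_eq ?_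
    rw [Real.mul_rpow (by positivity) (by positivity), ← Real.exp_mul, div_mul_cancel₀ _ hρ.ne']
  rw [Real.mul_rpow hm0.le (by positivity)] at h7
  rw [Real.exp_neg, Real.rpow_neg (by positivity), Real.inv_rpow hm0.le]
  have ht1 : 0 < (1 + t) ^ ρ := by positivity
  have hmr : 0 < m ^ ρ := by positivity
  rw [inv_le_iff_one_le_mul₀ (by positivity), ← div_eq_mul_inv, ← div_eq_inv_mul, div_div,
    div_mul_eq_mul_div, one_le_div (by positivity)]
  exact h7

theorem norm_exp_mul_le {c t : ℝ} {l : ℂ} (hl : c * ‖-l‖ ≤ (-l).re) (ht : 0 ≤ t) :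
    ‖exp (l * t)‖ ≤ Real.exp (-(c * (t / ‖l‖⁻¹))) := by
  rw [Complex.norm_exp, Complex.re_mul_ofReal, div_inv_eq_mul]
  rw [norm_neg, neg_re] at hl
  gcongr
  nlinarith

section
variable {q : ℝ} [hq : Fact (1 < q)] {lam : ℕ → ℂ} {z : ℂ}

/-- Polynomial decay of an orbit of the extended semigroup. -/
theorem exists_norm_extSemigroup_le {c ρ : ℝ} (hc : 0 < c) (hρ : 0 < ρ)
    (hlam : ∀ k, (lam k).re < 0) (hsec : ∀ k, c * ‖-lam k‖ ≤ (-lam k).re)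
    (hz : z ∈ resolventSetOf (diagOp q lam)) (y : Extrapolation q lam z hz)
    (hy : Memℓp (fun k => (((1 + ‖lam k‖⁻¹) ^ ρ : ℝ) : ℂ) * Extrapolation.resolventMap y k)
      (ENNReal.ofReal q)) :
    ∃ K : ℝ, 0 ≤ K ∧ ∀ t : ℝ, 0 ≤ t → ‖extSemigroup hz hlam t.toNNReal y‖ ≤ K * (1 + t) ^ (-ρ) := by
  obtain ⟨C, hC, h⟩ := exists_exp_neg_mul_le_one_add_rpow hc hρ
  refine ⟨C * ‖(⟨_, hy⟩ : Ell q)‖, by positivity, fun t ht => ?_⟩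
  have h1 : 0 ≤ C * (1 + t) ^ (-ρ) := by positivity
  have e : C * ‖(⟨_, hy⟩ : Ell q)‖ * (1 + t) ^ (-ρ)
      = ‖((C * (1 + t) ^ (-ρ) : ℝ) : ℂ) • (⟨_, hy⟩ : Ell q)‖ := by
    rw [norm_smul, Complex.norm_real, Real.norm_of_nonneg h1]; ring
  rw [e, Extrapolation.norm_def]
  refine lp.norm_mono (zero_lt_one.trans_le (factOneLeOfReal q).out).ne' fun k => ?_
  have h0 : lam k ≠ 0 := fun h => by simpa [h] using hlam k
  have hn : 0 < ‖lam k‖⁻¹ := inv_pos.mpr (norm_pos_iff.mpr h0)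
  rw [Extrapolation.resolventMap_apply, extSemigroup_coord, Real.coe_toNNReal t ht]
  change _ ≤ ‖((C * (1 + t) ^ (-ρ) : ℝ) : ℂ) *
    ((((1 + ‖lam k‖⁻¹) ^ ρ : ℝ) : ℂ) * Extrapolation.resolventMap y k)‖
  rw [Extrapolation.resolventMap_apply, mul_left_comm, norm_mul, ← mul_assoc, norm_mul,
    ← Complex.ofReal_mul, norm_mul, norm_mul, Complex.norm_real,
    Real.norm_of_nonneg (by positivity)]
  gcongr
  calc ‖exp (lam k * t)‖ ≤ _ := norm_exp_mul_le (hsec k) ht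
    _ ≤ _ := h t _ ht hn
    _ = _ := by ring

/-- Where `τ < 2` the factor is bounded and membership in the extrapolation space suffices. Where `τ
≥ 2` the resolvent is bounded by a constant and summability comes from `tsum_mul_rpow_ne_top`. -/
theorem memℓp_one_add_rpow_mul {p β : ℝ} (hqp : q < p) (hβ : 0 < β)
    (hlam : ∀ k, (lam k).re < 0)
    (hz : z ∈ resolventSetOf (diagOp q lam)) (y : Extrapolation q lam z hz)
    {S : ℝ → ℝ≥0∞} (hS : AEMeasurable S (volume.restrict (Ioi 0)))
    (hSt : ∫⁻ x in Ioi 0, S x ^ (p / (p - q)) ≠ ⊤)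
    (hwS : ∀ t, 0 < t → ∑' k, (Iic ‖lam k‖⁻¹).indicator (fun _ => ENNReal.ofReal
        (‖y.coord k‖ ^ q * ‖lam k‖⁻¹ ^ (q - 1) * (1 + ‖lam k‖⁻¹ ^ (q * β)))) t ≤ S t) :
    Memℓp (fun k => (((1 + ‖lam k‖⁻¹) ^ (1 - 1 / p + β / 2) : ℝ) : ℂ) *
      Extrapolation.resolventMap y k) (ENNReal.ofReal q) := by
  have hq1 := hq.out
  have hq0 : 0 < q := by linarith
  have hp0 : 0 < p := by linarith
  have hqr : (ENNReal.ofReal q).toReal = q := ENNReal.toReal_ofReal hq0.le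
  set ρ := 1 - 1 / p + β / 2 with hρ
  have hpi : 1 / p < 1 := (div_lt_one hp0).mpr (by linarith)
  have hρ0 : 0 < ρ := by linarith
  obtain ⟨M, hM0, hM⟩ := exists_norm_inv_sub_le hz
  -- Chosen so that `ρ q = (q - 1) + q β + (1 - κ)`, while `κ` still exceeds `q / p`.
  set κ := q / p + q * β / 2 with hκ
  have hfin := tsum_mul_rpow_ne_top hq0 hqp (κ := κ) (lt_add_of_pos_right _ (by positivity))
    hS hSt hwS
  have hs1 := ENNReal.summable_toReal hfin
  have hs2 : Summable fun k => ‖Extrapolation.resolventMap y k‖ ^ q := by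
    have := (memℓp_gen_iff (by rwa [hqr])).mp (lp.memℓp (Extrapolation.resolventMap y))
    rwa [hqr] at this
  rw [memℓp_gen_iff (by rwa [hqr]), hqr]
  refine Summable.of_nonneg_of_le (fun k => by positivity) (fun k => ?_)
    ((hs2.mul_left (3 ^ (ρ * q))).add (hs1.mul_left (2 ^ (ρ * q) * M ^ q)))
  have h0 : lam k ≠ 0 := fun h => by simpa [h] using hlam k
  set τ := ‖lam k‖⁻¹ with hτ
  have hτ0 : 0 < τ := inv_pos.mpr (norm_pos_iff.mpr h0)
  rw [norm_mul, Complex.norm_real, Real.norm_of_nonneg (by positivity),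
    Real.mul_rpow (by positivity) (by positivity), ← Real.rpow_mul (by positivity)]
  have hρq : 0 < ρ * q := by positivity
  by_cases h2 : τ ∈ Ici (2 : ℝ)
  · have h2' : (2 : ℝ) ≤ τ := h2
    refine le_add_of_nonneg_of_le (by positivity) ?_
    rw [indicator_of_mem h2, ← ENNReal.ofReal_mul (by positivity),
      ENNReal.toReal_ofReal (by positivity)]
    calc (1 + τ) ^ (ρ * q) * ‖Extrapolation.resolventMap y k‖ ^ q
        ≤ (2 * τ) ^ (ρ * q) * (M * ‖y.coord k‖) ^ q := by
          gcongr
          · linarith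
          · rw [Extrapolation.resolventMap_apply, norm_mul]
            gcongr
            exact hM k
      _ = 2 ^ (ρ * q) * M ^ q * (‖y.coord k‖ ^ q * τ ^ (q - 1) * (0 + τ ^ (q * β)) *
            τ ^ (1 - κ)) := by
          have e : ρ * q = q - 1 + q * β + (1 - κ) := by
            rw [hρ, hκ]; ring
          have e2 : τ ^ (ρ * q) = τ ^ (q - 1) * τ ^ (q * β) * τ ^ (1 - κ) := by
            rw [← Real.rpow_add hτ0, ← Real.rpow_add hτ0, e]
          rw [Real.mul_rpow (by positivity) hτ0.le, Real.mul_rpow hM0 (norm_nonneg _), e2]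
          ring
      _ ≤ _ := by
          gcongr
          exact zero_le_one
  · have h2' : τ < 2 := not_le.mp h2
    refine le_add_of_le_of_nonneg ?_ (by positivity)
    gcongr
    linarith

end

/-! ### Existence and coordinates of the Bochner integral -/

theorem memLp_one_add_rpow {r ρ : ℝ} (hr : 0 < r) (hρ : 1 < ρ * r) :
    MemLp (fun t : ℝ => (1 + ‖t‖) ^ (-ρ)) (ENNReal.ofReal r) volume := by
  have hm : AEStronglyMeasurable (fun t : ℝ => (1 + ‖t‖) ^ (-ρ)) volume :=
    Measurable.aestronglyMeasurable (by fun_prop)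
  rw [← integrable_norm_rpow_iff hm (by simpa using hr) ENNReal.ofReal_ne_top,
    ENNReal.toReal_ofReal hr.le]
  have h := integrable_one_add_norm (E := ℝ) (μ := volume) (r := ρ * r) (by simpa using hρ)
  refine h.congr (Filter.Eventually.of_forall fun t => ?_)
  change (1 + ‖t‖) ^ (-(ρ * r)) = ‖(1 + ‖t‖) ^ (-ρ)‖ ^ r
  rw [Real.norm_of_nonneg (r := (1 + ‖t‖) ^ (-ρ)) (by positivity),
    ← Real.rpow_mul (by positivity), neg_mul]

theorem halfLineNorm_le_sobolevNorm {p : ℝ} (hp : 0 < p) (β : ℝ) (u : ℝ → ℂ) :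
    halfLineNorm p u ≤ sobolevNorm p β u := by
  unfold sobolevNorm
  have h : ∀ v, 0 ≤ halfLineNorm p v := fun v => ENNReal.toReal_nonneg
  have h1 := Real.rpow_nonneg (h u) p
  have h2 := Real.rpow_nonneg (h (fracDeriv p β u)) p
  rw [one_div, Real.le_rpow_inv_iff_of_pos (h u) (by linarith) hp]
  linarith

section
variable {q : ℝ} [hq : Fact (1 < q)] {lam : ℕ → ℂ} {z : ℂ}
  {hz : z ∈ resolventSetOf (diagOp q lam)}

theorem extSemigroup_map_eq_smul (hlam : ∀ k, (lam k).re < 0)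
    (B : ℂ →L[ℂ] Extrapolation q lam z hz) (u : ℝ → ℂ) (t : ℝ) :
    extSemigroup hz hlam t.toNNReal (B (u t)) =
      u t • extSemigroup hz hlam t.toNNReal (B 1) := by
  rw [← map_smul, ← map_smul, smul_eq_mul, mul_one]

theorem coord_extSemigroup_map (hlam : ∀ k, (lam k).re < 0)
    (B : ℂ →L[ℂ] Extrapolation q lam z hz) (u : ℝ → ℂ) (t : ℝ) (k : ℕ) :
    (extSemigroup hz hlam t.toNNReal (B (u t))).coord k =
      u t * (exp (lam k * (t.toNNReal : ℝ)) * (B 1).coord k) := by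
  rw [extSemigroup_map_eq_smul, ← extSemigroup_coord hz hlam]
  rfl

/-- For an orbit of sufficient decay the integral `∫ T(t) B u(t) dt` exists as a Bochner integral
in the extrapolation space, for every `u ∈ L^p(0,∞)`. -/
theorem integrableOn_extSemigroup_map {p ρ K : ℝ} (hp : 1 < p) (hρ : 1 - 1 / p < ρ)
    (hlam : ∀ k, (lam k).re < 0) (B : ℂ →L[ℂ] Extrapolation q lam z hz)
    (hK : ∀ t : ℝ, 0 ≤ t → ‖extSemigroup hz hlam t.toNNReal (B 1)‖ ≤ K * (1 + t) ^ (-ρ))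
    {u : ℝ → ℂ} (hu : MemLpHalfLine p u) :
    IntegrableOn (fun t : ℝ => extSemigroup hz hlam t.toNNReal (B (u t))) (Ioi 0) := by
  obtain ⟨p', hpp⟩ : ∃ p', p.HolderConjugate p' := ⟨_, Real.HolderConjugate.conjExponent hp⟩
  have hp'0 : 0 < p' := hpp.symm.pos
  -- `1 - 1/p` is `1/p'`, so `(1 + t)^(-ρ)` lies in `L^(p')` and Hölder pairs it with `u`.
  have hρ' : 1 < ρ * p' := by
    have h1 : p'⁻¹ = 1 - 1 / p := by
      have := hpp.inv_add_inv_eq_one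
      rw [one_div]; linarith
    rw [← h1, inv_lt_iff_one_lt_mul₀ hp'0] at hρ
    exact hρ
  have hw := (memLp_one_add_rpow hp'0 hρ').restrict (Ioi 0)
  have : ENNReal.HolderConjugate (ENNReal.ofReal p) (ENNReal.ofReal p') := hpp.ennrealOfReal
  have hint : Integrable ((fun t => ‖u t‖) * fun t : ℝ => (1 + ‖t‖) ^ (-ρ))
      (volume.restrict (Ioi 0)) := MemLp.integrable_mul hu.norm hw
  refine Integrable.mono' (hint.const_mul K) ?_ ?_
  · refine aestronglyMeasurable_of_coord fun k => ?_
    simp only [coord_extSemigroup_map]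
    exact hu.1.mul (Continuous.aestronglyMeasurable (by fun_prop))
  · filter_upwards [ae_restrict_mem measurableSet_Ioi] with t ht
    have ht0 : (0 : ℝ) < t := ht
    rw [extSemigroup_map_eq_smul, norm_smul, Pi.mul_apply, Real.norm_of_nonneg ht0.le,
      mul_left_comm]
    exact mul_le_mul_of_nonneg_left (hK t ht0.le) (norm_nonneg _)

/-- Coordinates are continuous functionals on the extrapolation space, so they pass under the
Bochner integral. -/
theorem enorm_coord_integral_le {c : ℝ} (hlam : ∀ k, (lam k).re < 0)
    (hsec : ∀ k, c * ‖-lam k‖ ≤ (-lam k).re)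
    (B : ℂ →L[ℂ] Extrapolation q lam z hz) {u : ℝ → ℂ}
    (hint : IntegrableOn (fun t : ℝ => extSemigroup hz hlam t.toNNReal (B (u t))) (Ioi 0))
    (k : ℕ) :
    ‖(∫ t in Ioi (0 : ℝ), extSemigroup hz hlam t.toNNReal (B (u t))).coord k‖ₑ ≤
      ‖(B 1).coord k‖ₑ *
        ∫⁻ t in Ioi 0, ‖u t‖ₑ * ENNReal.ofReal (Real.exp (-(c * (t / ‖lam k‖⁻¹)))) := by
  rw [← coordCLM_apply, ← ContinuousLinearMap.integral_comp_comm _ hint]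
  refine (enorm_integral_le_lintegral_enorm _).trans ?_
  rw [← lintegral_const_mul' _ _ enorm_ne_top]
  refine setLIntegral_mono_ae' measurableSet_Ioi (Filter.Eventually.of_forall fun t ht => ?_)
  have ht0 : (0 : ℝ) < t := ht
  rw [coordCLM_apply, coord_extSemigroup_map, Real.coe_toNNReal t ht0.le, enorm_mul, enorm_mul,
    ← mul_assoc, mul_comm]
  gcongr
  rw [← ofReal_norm]
  exact ENNReal.ofReal_le_ofReal (norm_exp_mul_le (hsec k) ht0.le)

end

/-! ### Admissibility -/

theorem isAdmissible_of_memLp_balayage {p q β θ : ℝ} [hq : Fact (1 < q)] (hqp : q < p)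
    (hβ : 0 < β) (hθ : θ ∈ Ioo 0 (Real.pi / 2)) {lam : ℕ → ℂ} (hlam : ∀ k, (lam k).re < 0)
    (hsector : ∀ k, -lam k ∈ sector θ) {z : ℂ} (hz : z ∈ resolventSetOf (diagOp q lam))
    (B : ℂ →L[ℂ] Extrapolation q lam z hz)
    (hS : MemLp (balayage (inversion q (sobolevWeight β q (carlesonMeasure q lam (B 1).coord))))
      (ENNReal.ofReal (p / (p - q))) volume) :
    IsAdmissible hlam B p β := by
  have hq1 := hq.out
  have hq0 : 0 < q := by linarith
  have hp0 : 0 < p := by linarith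
  have hpq : 0 < p - q := sub_pos.mpr hqp
  set c := Real.cos θ with hcθ
  have hc : 0 < c := Real.cos_pos_of_mem_Ioo ⟨by linarith [hθ.1, Real.pi_pos], hθ.2⟩
  have hsec : ∀ k, c * ‖-lam k‖ ≤ (-lam k).re := fun k => cos_mul_norm_le_re hθ (hsector k)
  have hτ : ∀ k, 0 < ‖lam k‖⁻¹ := fun k =>
    inv_pos.mpr (norm_pos_iff.mpr fun h => by simpa [h] using hlam k)
  set b := (B 1).coord with hb
  set W := balayage (inversion q (sobolevWeight β q (carlesonMeasure q lam b))) with hW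
  set S : ℝ → ℝ≥0∞ := fun t => ENNReal.ofReal (4 * Real.pi / c) * W t with hSdef
  have hSm : AEMeasurable S (volume.restrict (Ioi 0)) :=
    (hS.1.aemeasurable.restrict).const_mul _
  have hs0 : 0 < p / (p - q) := by positivity
  have hWt : ∫⁻ x, W x ^ (p / (p - q)) ≠ ⊤ := by
    have h := hS.2
    rw [eLpNorm_lt_top_iff_lintegral_rpow_enorm_lt_top (by simpa using hs0) ENNReal.ofReal_ne_top,
      ENNReal.toReal_ofReal hs0.le] at h
    simpa only [enorm_eq_self] using h.ne
  have hSt : ∫⁻ x in Ioi 0, S x ^ (p / (p - q)) ≠ ⊤ := by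
    simp only [hSdef, ENNReal.mul_rpow_of_nonneg _ _ hs0.le]
    rw [lintegral_const_mul' _ _ (ENNReal.rpow_ne_top_of_nonneg hs0.le ENNReal.ofReal_ne_top)]
    exact ENNReal.mul_ne_top (ENNReal.rpow_ne_top_of_nonneg hs0.le ENNReal.ofReal_ne_top)
      (ne_top_of_le_ne_top hWt (setLIntegral_le_lintegral _ _))
  have hwS := fun t (ht : 0 < t) => tsum_indicator_le_balayage (q := q) (β := β) hc hlam hsec b ht
  obtain ⟨K, -, hK⟩ := exists_norm_extSemigroup_le hc
    (by have : 1 / p < 1 := (div_lt_one hp0).mpr (by linarith)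
        linarith : 0 < 1 - 1 / p + β / 2) hlam hsec hz (B 1)
    (memℓp_one_add_rpow_mul hqp hβ hlam hz (B 1) hSm hSt hwS)
  obtain ⟨C, hC, hCU⟩ := exists_tsum_laplace_rpow_le hq1 hqp hc hτ hSm hSt hwS
  -- The added `1` only makes the constant positive.
  refine ⟨(C ^ (1 / q)).toReal + 1, by positivity, fun u hu => ?_⟩
  have hint := integrableOn_extSemigroup_map (hq1.trans hqp) (by linarith) hlam B hK hu.1
  refine ⟨hint, ?_⟩
  have huL := hu.1
  set N := eLpNorm u (ENNReal.ofReal p) (volume.restrict (Ioi 0)) with hN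
  have hNt : N ≠ ⊤ := huL.2.ne
  -- The embedding is stated for measurable functions, so `u` is replaced by a measurable
  -- representative.
  set U : ℝ → ℝ≥0∞ := fun t => ‖huL.1.mk u t‖ₑ with hU
  have hUm : Measurable U := huL.1.stronglyMeasurable_mk.measurable.enorm
  have hUu : (fun t => ‖u t‖ₑ) =ᵐ[volume.restrict (Ioi 0)] U :=
    huL.1.ae_eq_mk.fun_comp fun v => ‖v‖ₑ
  have hUN : (∫⁻ t in Ioi 0, U t ^ p) ^ (q / p) = N ^ q := by
    rw [hN, eLpNorm_eq_lintegral_rpow_enorm_toReal (by simpa using hp0) ENNReal.ofReal_ne_top,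
      ENNReal.toReal_ofReal hp0.le, ← ENNReal.rpow_mul, one_div_mul_eq_div]
    congr 1
    exact lintegral_congr_ae (hUu.symm.fun_comp fun v => v ^ p)
  set X := ∫ t in Ioi (0 : ℝ), extSemigroup hz hlam t.toNNReal (B (u t)) with hX
  have hsum : ∑' k, ‖X.coord k‖ₑ ^ q ≤ C * N ^ q := by
    rw [← hUN]
    refine le_trans (ENNReal.tsum_le_tsum fun k => ?_) (hCU U hUm)
    have h1 := enorm_coord_integral_le hlam hsec B hint k
    have h2 : ∫⁻ t in Ioi 0, ‖u t‖ₑ * ENNReal.ofReal (Real.exp (-(c * (t / ‖lam k‖⁻¹)))) =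
        ∫⁻ t in Ioi 0, U t * ENNReal.ofReal (Real.exp (-(c * (t / ‖lam k‖⁻¹)))) :=
      lintegral_congr_ae (hUu.mul (Filter.EventuallyEq.refl _ _))
    rw [h2] at h1
    refine (ENNReal.rpow_le_rpow h1 hq0.le).trans ?_
    have hk := hτ k
    rw [ENNReal.mul_rpow_of_nonneg _ _ hq0.le, ← mul_assoc, ← ENNReal.ofReal_mul (by positivity)]
    refine mul_le_mul_left ?_ _
    rw [← ofReal_norm, ENNReal.ofReal_rpow_of_nonneg (norm_nonneg _) hq0.le]
    refine ENNReal.ofReal_le_ofReal ?_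
    -- The powers `τ^(q-1)` and `τ^(1-q)` cancel, and the remaining factor `1 + τ^(qβ)` is at least
    -- `1`.
    rw [mul_right_comm, mul_assoc (‖b k‖ ^ q), ← Real.rpow_add hk,
      show q - 1 + (1 - q) = 0 by ring, Real.rpow_zero, mul_one]
    exact le_mul_of_one_le_right (by positivity) (le_add_of_nonneg_right (by positivity))
  obtain ⟨x, hx, hxn⟩ := exists_ell_norm_le_of_tsum_le hq1
    (ENNReal.mul_ne_top hC (ENNReal.rpow_ne_top_of_nonneg hq0.le hNt)) hsum
  refine ⟨x, Extrapolation.ext hx, hxn.trans ?_⟩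
  rw [ENNReal.mul_rpow_of_nonneg _ _ (by positivity), ← ENNReal.rpow_mul,
    mul_one_div_cancel hq0.ne', ENNReal.rpow_one, ENNReal.toReal_mul]
  have hle : N.toReal ≤ sobolevNorm p β u := halfLineNorm_le_sobolevNorm hp0 β u
  have hN0 : 0 ≤ N.toReal := ENNReal.toReal_nonneg
  gcongr
  linarith

end WeightedAdmissibility

end

theorem mainTheorem11 (p q β θ : ℝ) [hq : Fact (1 < q)] (hqp : q < p) (hβ : 0 < β)
    (hθ : θ ∈ Set.Ioo 0 (Real.pi / 2))
    (lam : ℕ → ℂ) (hlam : ∀ k, (lam k).re < 0)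
    (hsector : ∀ k, -lam k ∈ WeightedAdmissibility.sector θ)
    (z : ℂ)
    (hz : z ∈ WeightedAdmissibility.resolventSetOf (WeightedAdmissibility.diagOp q lam))
    (B : ℂ →L[ℂ] WeightedAdmissibility.Extrapolation q lam z hz)
    (hS : MeasureTheory.MemLp
      (WeightedAdmissibility.balayage
        (WeightedAdmissibility.inversion q
          (WeightedAdmissibility.sobolevWeight β q
            (WeightedAdmissibility.carlesonMeasure q lam (B 1).coord))))
      (ENNReal.ofReal (p / (p - q))) MeasureTheory.volume) :
    WeightedAdmissibility.IsAdmissible hlam B p β := by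
  exact WeightedAdmissibility.isAdmissible_of_memLp_balayage hqp hβ hθ hlam hsector hz B hS
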